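/- For a nonzero integer $q$ let $\Gamma_q=\langle x,y,z\mid [x,y]=z^q,\ zx=xz,\ zy=yz\rangle$. For a commutative ring $R$, regarded as a trivial $\Gamma_q$-module, identify $H^1(\Gamma_q;R)$ with $\mathrm{Hom}(\Gamma_q,R)$. If $R=\mathbb{Z}$ or $R$ is a field of characteristic $\neq 2$, let $c^R:\wedge_2H^1(\Gamma_q;R)\to H^2(\Gamma_q;R)$ be the homomorphism $a\wedge b\mapsto a\cup b$. Let $f,g:\Gamma_q\to\mathbb{Z}$ be the homomorphisms with $f(x)=1$, $f(y)=f(z)=0$ and $g(y)=1$, $g(x)=g(z)=0$, and for a prime $p$ let $\overline f_p,\overline g_p:\Gamma_q\to\mathbb{F}_p$ be their mod-$p$ reductions. Then: 1. $\dim_{\mathbb{Q}}H^1(\Gamma_q;\mathbb{Q})=2$ and $c^{\mathbb{Q}}=0$; in particular the image of $f\cup g$ in $H^2(\Gamma_q;\mathbb{Q})$ is $0$. 2. $H^2(\Gamma_q;\mathbb{Z})\cong\mathbb{Z}^2\oplus\mathbb{Z}/q\mathbb{Z}$, the torsion subgroup of $H^2(\Gamma_q;\mathbb{Z})$ is generated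 by $f\cup g$, and it contains all cup products of elements of $H^1(\Gamma_q;\mathbb{Z})$. 3. If $p$ is a prime dividing $q$ then $\overline f_p\cup\overline g_p\neq 0$ in $H^2(\Gamma_q;\mathbb{F}_p)$, and $c^{\mathbb{Z}}\neq 0$. 4. If $p$ is an odd prime dividing $q$, let $h:\Gamma_q\to\mathbb{F}_p$ be the homomorphism with $h(x)=h(y)=0$ and $h(z)=1$. Then $c^{\mathbb{F}_p}$ is injective; reduction mod $p$ maps $H^2(\Gamma_q;\mathbb{Z})$ onto $H^2(\Gamma_q;\mathbb{F}_p)$; the classes $\overline f_p\cup h$, $\overline g_p\cup h$, $\overline f_p\cup\overline g_p$ form a basis of $H^2(\Gamma_q;\mathbb{F}_p)$; the homomorphism $h$ does not lift to a homomorphism $\Gamma_q\to\mathbb{Z}$; and each of $\overline f_p\cup h$ and $\overline g_p\cup h$ is the mod-$p$ reduction of a class of infinite order in $H^2(\Gamma_q;\mathbb{Z})$, but not of a cup product of two elements of $H^1(\Gamma_q;\mathbb{Z})$. -/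

import Mathlib

open CategoryTheory groupCohomology

noncomputable section

namespace CupNil

/-! ### Cup product of degree one classes with trivial coefficients -/

section Cup

/-- `H¹(G; R)`, with `R` a trivial `G`-module. -/
abbrev HOne (R G : Type) [CommRing R] [Group G] : ModuleCat R := H1 (Rep.trivial R G R)

/-- `H²(G; R)`, with `R` a trivial `G`-module. -/
abbrev HTwo (R G : Type) [CommRing R] [Group G] : ModuleCat R := H2 (Rep.trivial R G R)

variable (R G : Type) [CommRing R] [Group G]

/-- The canonical isomorphism `H¹(G; R) ≅ Hom(G, R)`. -/
def homEquiv : HOne R G ≃ₗ[R] (Additive G →+ R) :=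
  (H1IsoOfIsTrivial (Rep.trivial R G R)).toLinearEquiv

variable {R G} in
/-- The class in `H¹(G; R)` of a homomorphism `G → R`. -/
def homClass (φ : Additive G →+ R) : HOne R G := (homEquiv R G).symm φ

variable {R G} in
theorem homEquiv_homClass (φ : Additive G →+ R) : homEquiv R G (homClass φ) = φ :=
  (homEquiv R G).apply_symm_apply φ

variable {R G} in
theorem homClass_homEquiv (a : HOne R G) : homClass (homEquiv R G a) = a :=
  (homEquiv R G).symm_apply_apply a

variable {R G} in
theorem cupCochain_mem (φ ψ : Additive G →+ R) :
    (fun gh : G × G => φ (Additive.ofMul gh.1) * ψ (Additive.ofMul gh.2)) ∈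
      cocycles₂ (Rep.trivial R G R) := by
  rw [mem_cocycles₂_iff]
  intro g h j
  change φ (Additive.ofMul (g * h)) * ψ (Additive.ofMul j) +
      φ (Additive.ofMul g) * ψ (Additive.ofMul h) =
    φ (Additive.ofMul h) * ψ (Additive.ofMul j) +
      φ (Additive.ofMul g) * ψ (Additive.ofMul (h * j))
  simp only [ofMul_mul, map_add]
  ring

variable {R G} in
/-- The inhomogeneous 2-cocycle `(g, h) ↦ φ(g) ψ(h)`: the cup product of two 1-cocycles. -/
def cupCocycle (φ ψ : Additive G →+ R) : cocycles₂ (Rep.trivial R G R) :=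
  ⟨fun gh : G × G => φ (Additive.ofMul gh.1) * ψ (Additive.ofMul gh.2), cupCochain_mem φ ψ⟩

/-- The cup product `H¹(G; R) × H¹(G; R) → H²(G; R)`. (With trivial coefficients there are no
nonzero 1-coboundaries, so each class in `H¹` is represented by a unique 1-cocycle.) -/
def cup : HOne R G →ₗ[R] HOne R G →ₗ[R] HTwo R G :=
  LinearMap.mk₂ R
    (fun a b => (H2π (Rep.trivial R G R)).hom (cupCocycle (homEquiv R G a) (homEquiv R G b)))
    (by
      intro a a' b
      rw [← map_add]
      congr 1
      refine Subtype.ext (funext fun gh => ?_)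
      simp only [map_add]
      exact add_mul _ _ _)
    (by
      intro c a b
      rw [← map_smul]
      congr 1
      refine Subtype.ext (funext fun gh => ?_)
      simp only [map_smul]
      exact smul_mul_assoc _ _ _)
    (by
      intro a b b'
      rw [← map_add]
      congr 1
      refine Subtype.ext (funext fun gh => ?_)
      simp only [map_add]
      exact mul_add _ _ _)
    (by
      intro c a b
      rw [← map_smul]
      congr 1
      refine Subtype.ext (funext fun gh => ?_)
      simp only [map_smul]
      exact mul_smul_comm _ _ _)

theorem cup_apply (a b : HOne R G) :
    cup R G a b =
      (H2π (Rep.trivial R G R)).hom (cupCocycle (homEquiv R G a) (homEquiv R G b)) := rfl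

/-- Cup squares of degree one classes vanish as soon as `t ↦ t²` is the polarization of some
function `s : R → R`. -/
theorem cup_self_of_polarization (s : R → R) (hs : ∀ t u, s (t + u) = s t + s u + t * u)
    (a : HOne R G) : cup R G a a = 0 := by
  rw [cup_apply]
  refine (H2π_eq_zero_iff _).2 ?_
  refine ⟨fun g => - s (homEquiv R G a (Additive.ofMul g)), ?_⟩
  funext gh
  obtain ⟨g, h⟩ := gh
  rw [d₁₂_hom_apply]
  change - s _ - - s _ + - s _ = homEquiv R G a (Additive.ofMul g) * homEquiv R G a (Additive.ofMul h)
  rw [ofMul_mul, map_add, hs]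
  ring

/-- Over a field of characteristic different from 2, cup squares of degree one classes vanish. -/
theorem cup_self_field (F : Type) [Field F] (h2 : (2 : F) ≠ 0) (a : HOne F G) :
    cup F G a a = 0 :=
  cup_self_of_polarization F G (fun t => t ^ 2 / 2) (fun t u => by field_simp; ring) a

/-- Integral cup squares of degree one classes vanish. -/
theorem cup_self_int (a : HOne ℤ G) : cup ℤ G a a = 0 := by
  refine cup_self_of_polarization ℤ G (fun t => t * (t - 1) / 2) (fun t u => ?_) a
  obtain ⟨m, hm⟩ := (Int.even_mul_pred_self t).two_dvd
  obtain ⟨n, hn⟩ := (Int.even_mul_pred_self u).two_dvd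
  have h : (t + u) * (t + u - 1) = 2 * (m + n + t * u) := by linear_combination hm + hn
  simp only [h, hm, hn]
  omega

/-- The homomorphism `⋀² H¹(G; R) → H²(G; R)`, `a ∧ b ↦ a ∪ b`, for `R` such that cup squares
of degree one classes vanish. -/
def wedgeCup (halt : ∀ a : HOne R G, cup R G a a = 0) :
    ⋀[R]^2 (HOne R G) →ₗ[R] HTwo R G :=
  exteriorPower.alternatingMapLinearEquiv
    { toFun := fun v => cup R G (v 0) (v 1)
      map_update_add' := by
        intro inst v i x y
        obtain rfl : inst = instDecidableEqFin 2 := Subsingleton.elim _ _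
        fin_cases i <;> simp
      map_update_smul' := by
        intro inst v i c x
        obtain rfl : inst = instDecidableEqFin 2 := Subsingleton.elim _ _
        fin_cases i <;> simp
      map_eq_zero_of_eq' := by
        intro v i j hij hne
        have h01 : v 0 = v 1 := by
          fin_cases i <;> fin_cases j <;> first | exact absurd rfl hne | exact hij | exact hij.symm
        rw [h01]
        exact halt _ }

theorem wedgeCup_ιMulti (halt : ∀ a : HOne R G, cup R G a a = 0) (a b : HOne R G) :
    wedgeCup R G halt (exteriorPower.ιMulti R 2 ![a, b]) = cup R G a b := by
  simp [wedgeCup]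

end Cup

/-! ### Change of coefficients -/

section Coeff

variable {R S : Type} [CommRing R] [CommRing S] (ρ : R →+* S) (G : Type) [Group G]

/-- Composition with a ring homomorphism, on 2-cocycles. -/
def coeffCocycle : cocycles₂ (Rep.trivial R G R) →+ cocycles₂ (Rep.trivial S G S) where
  toFun x := ⟨fun gh => ρ (x.1 gh), by
    rw [mem_cocycles₂_iff]
    intro g h j
    have := (mem_cocycles₂_iff (A := Rep.trivial R G R) x).1 x.2 g h j
    change x.1 (g * h, j) + x.1 (g, h) = x.1 (h, j) + x.1 (g, h * j) at this
    change ρ (x.1 (g * h, j)) + ρ (x.1 (g, h)) = ρ (x.1 (h, j)) + ρ (x.1 (g, h * j))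
    rw [← map_add ρ, ← map_add ρ, this]⟩
  map_zero' := Subtype.ext (funext fun _ => map_zero ρ)
  map_add' _ _ := Subtype.ext (funext fun _ => map_add ρ _ _)

theorem H2π_surjective : Function.Surjective (H2π (Rep.trivial R G R)).hom :=
  (ModuleCat.epi_iff_surjective _).1 inferInstance

/-- The homomorphism `H²(G; R) → H²(G; S)` induced by a ring homomorphism `ρ : R → S`. -/
def coeffMap : HTwo R G →+ HTwo S G :=
  AddMonoidHom.liftOfSurjective (H2π (Rep.trivial R G R)).hom.toAddMonoidHom
    (H2π_surjective (R := R) G)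
    ⟨(H2π (Rep.trivial S G S)).hom.toAddMonoidHom.comp (coeffCocycle ρ G), by
      intro x hx
      obtain ⟨c, hc⟩ := (H2π_eq_zero_iff _).1 hx
      refine (H2π_eq_zero_iff _).2 ⟨fun g => ρ (c g), ?_⟩
      funext gh
      obtain ⟨g, h⟩ := gh
      have h1 := congrFun hc (g, h)
      rw [d₁₂_hom_apply] at h1 ⊢
      have h2 := congrArg ρ h1
      change ρ (c h - c (g * h) + c g) = _ at h2
      rw [map_add, map_sub] at h2
      exact h2⟩

theorem coeffMap_H2π (x : cocycles₂ (Rep.trivial R G R)) :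
    coeffMap ρ G ((H2π (Rep.trivial R G R)).hom x) =
      (H2π (Rep.trivial S G S)).hom (coeffCocycle ρ G x) :=
  AddMonoidHom.liftOfRightInverse_comp_apply _ _ _ _ x

/-- Change of coefficients is compatible with the cup product. -/
theorem coeffMap_cup (φ ψ : Additive G →+ R) :
    coeffMap ρ G (cup R G (homClass φ) (homClass ψ)) =
      cup S G (homClass (ρ.toAddMonoidHom.comp φ)) (homClass (ρ.toAddMonoidHom.comp ψ)) := by
  rw [cup_apply, cup_apply, coeffMap_H2π]
  simp only [homEquiv_homClass]
  congr 1
  exact Subtype.ext (funext fun _ => map_mul ρ _ _)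

end Coeff

/-! ### The groups `⟨x, y, z ∣ [x, y] = z ^ q, z x = x z, z y = y z⟩` -/

section Gamma

/-- The relators; the generators `x, y, z` are indexed by `0, 1, 2`. -/
def relators (q : ℤ) : Set (FreeGroup (Fin 3)) :=
  let x := FreeGroup.of (0 : Fin 3)
  let y := FreeGroup.of (1 : Fin 3)
  let z := FreeGroup.of (2 : Fin 3)
  {x * y * x⁻¹ * y⁻¹ * (z ^ q)⁻¹, z * x * (x * z)⁻¹, z * y * (y * z)⁻¹}

/-- The group with presentation `⟨x, y, z ∣ [x, y] = z ^ q, z x = x z, z y = y z⟩`. -/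
abbrev Gamma (q : ℤ) : Type := PresentedGroup (relators q)

/-- The generators `x, y, z`, written additively. -/
def gen (q : ℤ) (i : Fin 3) : Additive (Gamma q) := Additive.ofMul (PresentedGroup.of i)

variable {A : Type} [AddCommGroup A]

theorem relators_lift (q : ℤ) (v : Fin 3 → A) (hv : q • v 2 = 0) :
    ∀ r ∈ relators q, FreeGroup.lift (fun i => Multiplicative.ofAdd (v i)) r = 1 := by
  intro r hr
  rcases hr with rfl | rfl | rfl
  · have h : (Multiplicative.ofAdd (v 2)) ^ q = 1 := by
      rw [← ofAdd_zsmul, hv, ofAdd_zero]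
    simp [h]
  · simp [← mul_assoc, mul_comm]
  · simp [← mul_assoc, mul_comm]

/-- The homomorphism to an abelian group `A` with given values `v` on `x, y, z`,
provided that `q • v(z) = 0`. -/
def homOfValues (q : ℤ) (v : Fin 3 → A) (hv : q • v 2 = 0) : Additive (Gamma q) →+ A :=
  MonoidHom.toAdditiveLeft (PresentedGroup.toGroup (relators_lift q v hv))

theorem homOfValues_gen (q : ℤ) (v : Fin 3 → A) (hv : q • v 2 = 0) (i : Fin 3) :
    homOfValues q v hv (gen q i) = v i :=
  congrArg Multiplicative.toAdd (PresentedGroup.toGroup.of (relators_lift q v hv))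

/-- `f : Γ → ℤ`, with `f(x) = 1` and `f(y) = f(z) = 0`. -/
def f (q : ℤ) : Additive (Gamma q) →+ ℤ := homOfValues q ![1, 0, 0] (by simp)

/-- `g : Γ → ℤ`, with `g(y) = 1` and `g(x) = g(z) = 0`. -/
def g (q : ℤ) : Additive (Gamma q) →+ ℤ := homOfValues q ![0, 1, 0] (by simp)

/-- `h : Γ → 𝔽_p`, with `h(x) = h(y) = 0` and `h(z) = 1`; here `p` divides `q`. -/
def h (q : ℤ) (p : ℕ) (hpq : (p : ℤ) ∣ q) : Additive (Gamma q) →+ ZMod p :=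
  homOfValues q ![0, 0, 1] (by simpa using (ZMod.intCast_zmod_eq_zero_iff_dvd q p).2 hpq)

/-- The mod-`p` reduction of a homomorphism to `ℤ`. -/
def modp {G : Type} [Group G] (p : ℕ) (φ : Additive G →+ ℤ) : Additive G →+ ZMod p :=
  (Int.castAddHom (ZMod p)).comp φ

/-- `2 ≠ 0` in `𝔽_p` for an odd prime `p`. -/
theorem two_ne_zero_of_odd (p : ℕ) [Fact p.Prime] (hp : p ≠ 2) : (2 : ZMod p) ≠ 0 := by
  have : Fact (2 < p) := ⟨lt_of_le_of_ne (Fact.out : p.Prime).two_le hp.symm⟩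
  exact_mod_cast ZMod.prime_ne_zero p 2 hp

end Gamma

end CupNil

end

/-! A 2-cocycle `F` of a presented group defines a central extension by `R`, in which each relator
lifts to an element of the kernel `R`. The class of `F` is zero exactly when these elements are the
values on the relators of a homomorphism from the free group (`H2π_eq_zero_iff_wordEval`), since the
generators can then be lifted so that all relators die, which splits the extension. For `Γ` such
homomorphisms vanish on `[z, x]` and `[z, y]` and take all multiples of `q` on `[x, y] z^{-q}`.
Hence `H²(Γ; R)` embeds in `R² ⊕ R/q`. It is everything, because three integral cocycles hit the
standard generators: `f ∪ g`, and corrected forms of `f ∪ c` and `c ∪ g`, where `c` is the exponent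
of `z`. As `c` has coboundary a multiple of `q`, it reduces to `h` modulo `p ∣ q`, and the
corrections vanish there. So `h2Equiv` gives coordinates, compatible with change of coefficients, in
which the claims can be read off. In characteristic zero every homomorphism kills `z`, so all cup
products on `H¹` are multiples of `f ∪ g`, which lies in the summand `R/q`. -/

noncomputable section

namespace CupNil

/-! ### Central extensions and the values of 2-cocycles on relators. -/

section Trivialization

variable {R G : Type} [CommRing R] [Group G]

/-- The value of a 2-cocycle with trivial coefficients. -/
def cocycleVal (F : cocycles₂ (Rep.trivial R G R)) (a b : G) : R := F.1 (a, b)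

theorem cocycleVal_add (F F' : cocycles₂ (Rep.trivial R G R)) (a b : G) :
    cocycleVal (F + F') a b = cocycleVal F a b + cocycleVal F' a b := rfl

theorem cocycleVal_smul (r : R) (F : cocycles₂ (Rep.trivial R G R)) (a b : G) :
    cocycleVal (r • F) a b = r * cocycleVal F a b := rfl

theorem cocycleVal_mul (F : cocycles₂ (Rep.trivial R G R)) (a b c : G) :
    cocycleVal F (a * b) c + cocycleVal F a b = cocycleVal F b c + cocycleVal F a (b * c) :=
  (mem_cocycles₂_iff (A := Rep.trivial R G R) F.1).1 F.2 a b c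

theorem cocycleVal_one_left (F : cocycles₂ (Rep.trivial R G R)) (a : G) :
    cocycleVal F 1 a = cocycleVal F 1 1 := by
  have := cocycleVal_mul F 1 1 a
  simp only [one_mul] at this
  exact (add_left_cancel this).symm

/-- A class vanishes if and only if its cocycle is the defect of additivity of some function. -/
theorem H2π_eq_zero_iff_exists (F : cocycles₂ (Rep.trivial R G R)) :
    (H2π (Rep.trivial R G R)).hom F = 0 ↔
      ∃ c : G → R, ∀ a b, c (a * b) = c a + c b + cocycleVal F a b := by
  constructor
  · intro hF
    obtain ⟨c, hc⟩ := (H2π_eq_zero_iff _).1 hF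
    refine ⟨fun a => - (c a : R), fun a b => ?_⟩
    have h1 := congrFun hc (a, b)
    rw [d₁₂_hom_apply] at h1
    change (c b - c (a * b) + c a : R) = cocycleVal F a b at h1
    rw [← h1]
    ring
  · rintro ⟨c, hc⟩
    refine (H2π_eq_zero_iff _).2 ⟨fun a => (- c a : R), ?_⟩
    funext ab
    obtain ⟨a, b⟩ := ab
    rw [d₁₂_hom_apply]
    change - c b - - c (a * b) + - c a = cocycleVal F a b
    rw [hc]
    ring

/-- The central extension of `G` by `R` defined by a 2-cocycle. -/
@[ext]
structure CocycleExtension (F : cocycles₂ (Rep.trivial R G R)) where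
  /-- The coordinate in the kernel. -/
  coeff : R
  /-- The image in the quotient. -/
  base : G

namespace CocycleExtension

variable (F : cocycles₂ (Rep.trivial R G R))

instance : Mul (CocycleExtension F) :=
  ⟨fun a b => ⟨a.coeff + b.coeff + cocycleVal F a.base b.base, a.base * b.base⟩⟩

/-- Cocycles are not assumed normalized; this is the source of the term `cocycleVal F 1 1` in the
inverse and in `wordEval`. -/
instance : One (CocycleExtension F) := ⟨⟨- cocycleVal F 1 1, 1⟩⟩

instance : Inv (CocycleExtension F) :=
  ⟨fun a => ⟨- a.coeff - cocycleVal F 1 1 - cocycleVal F a.base⁻¹ a.base, a.base⁻¹⟩⟩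

theorem coeff_mul (a b : CocycleExtension F) :
    (a * b).coeff = a.coeff + b.coeff + cocycleVal F a.base b.base := rfl

theorem base_mul (a b : CocycleExtension F) : (a * b).base = a.base * b.base := rfl

theorem coeff_one : (1 : CocycleExtension F).coeff = - cocycleVal F 1 1 := rfl

theorem base_one : (1 : CocycleExtension F).base = 1 := rfl

theorem coeff_inv (a : CocycleExtension F) :
    a⁻¹.coeff = - a.coeff - cocycleVal F 1 1 - cocycleVal F a.base⁻¹ a.base := rfl

theorem base_inv (a : CocycleExtension F) : a⁻¹.base = a.base⁻¹ := rfl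

instance : Group (CocycleExtension F) :=
  Group.ofLeftAxioms
    (fun a b c => by
      ext
      · have := cocycleVal_mul F a.base b.base c.base
        simp only [coeff_mul, base_mul]
        linear_combination this
      · simp only [base_mul, mul_assoc])
    (fun a => by
      ext
      · simp only [coeff_mul, base_one, coeff_one, cocycleVal_one_left]
        ring
      · simp only [base_mul, base_one, one_mul])
    (fun a => by
      ext
      · simp only [coeff_mul, coeff_inv, base_inv, coeff_one]
        ring
      · simp only [base_mul, base_inv, base_one, inv_mul_cancel])

/-- The projection of the extension onto the quotient. -/
def proj : CocycleExtension F →* G where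
  toFun := base
  map_one' := rfl
  map_mul' _ _ := rfl

end CocycleExtension

variable {ι : Type}

/-- The lift to the extension of a homomorphism out of a free group, with prescribed coefficients
on the generators. -/
def extensionLift (F : cocycles₂ (Rep.trivial R G R)) (π : FreeGroup ι →* G) (v : ι → R) :
    FreeGroup ι →* CocycleExtension F :=
  FreeGroup.lift fun i => ⟨v i, π (FreeGroup.of i)⟩

theorem base_extensionLift (F : cocycles₂ (Rep.trivial R G R)) (π : FreeGroup ι →* G) (v : ι → R)
    (w : FreeGroup ι) : (extensionLift F π v w).base = π w := by
  have : (CocycleExtension.proj F).comp (extensionLift F π v) = π := by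
    ext i
    simp [extensionLift, CocycleExtension.proj]
  exact DFunLike.congr_fun this w

/-- The function on a free group that trivializes the pullback of a 2-cocycle and vanishes on the
generators. -/
def freeTriv (F : cocycles₂ (Rep.trivial R G R)) (π : FreeGroup ι →* G) (w : FreeGroup ι) : R :=
  (extensionLift F π 0 w).coeff

variable (F F' : cocycles₂ (Rep.trivial R G R)) (π : FreeGroup ι →* G)

theorem freeTriv_of (i : ι) : freeTriv F π (FreeGroup.of i) = 0 := by
  simp [freeTriv, extensionLift]

theorem freeTriv_mul (w w' : FreeGroup ι) :
    freeTriv F π (w * w') = freeTriv F π w + freeTriv F π w' + cocycleVal F (π w) (π w') := by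
  simp only [freeTriv, map_mul, CocycleExtension.coeff_mul, base_extensionLift]

theorem freeTriv_one : freeTriv F π 1 = - cocycleVal F 1 1 := by
  simp only [freeTriv, map_one, CocycleExtension.coeff_one]

/-- Two trivializations of the pullback of a 2-cocycle to a free group differ by a
homomorphism. -/
theorem exists_hom_of_trivializations {u v : FreeGroup ι → R}
    (hu : ∀ w w', u (w * w') = u w + u w' + cocycleVal F (π w) (π w'))
    (hv : ∀ w w', v (w * w') = v w + v w' + cocycleVal F (π w) (π w')) :
    ∃ l : FreeGroup ι →* Multiplicative R, ∀ w, u w = v w + (l w).toAdd := by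
  refine ⟨MonoidHom.mk' (fun w => Multiplicative.ofAdd (u w - v w)) fun w w' => ?_, fun w => ?_⟩
  · rw [← ofAdd_add, hu, hv]
    congr 1
    ring
  · simp

/-- The difference of two trivializations is a homomorphism, and it vanishes on the generators. This
uniqueness makes `freeTriv` linear in the cocycle. -/
theorem eq_freeTriv {u : FreeGroup ι → R} (h0 : ∀ i, u (FreeGroup.of i) = 0)
    (hu : ∀ w w', u (w * w') = u w + u w' + cocycleVal F (π w) (π w')) :
    u = freeTriv F π := by
  obtain ⟨l, hl⟩ := exists_hom_of_trivializations F π hu (freeTriv_mul F π)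
  have : l = 1 := by
    ext i
    have := hl (FreeGroup.of i)
    rw [h0, freeTriv_of, zero_add] at this
    exact this.symm
  funext w
  rw [hl, this]
  simp

theorem freeTriv_add : freeTriv (F + F') π = freeTriv F π + freeTriv F' π := by
  refine (eq_freeTriv _ _ (fun i => ?_) fun w w' => ?_).symm
  · simp [freeTriv_of]
  · simp only [Pi.add_apply, freeTriv_mul, cocycleVal_add]
    ring

theorem freeTriv_smul (r : R) : freeTriv (r • F) π = r • freeTriv F π := by
  refine (eq_freeTriv _ _ (fun i => ?_) fun w w' => ?_).symm
  · simp [freeTriv_of]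
  · simp only [Pi.smul_apply, smul_eq_mul, freeTriv_mul, cocycleVal_smul]
    ring

/-- The value of a 2-cocycle on a word of the free group: if the word is a relation, this is the
element of the kernel to which it lifts in the central extension. -/
def wordEval (π : FreeGroup ι →* G) (w : FreeGroup ι) : cocycles₂ (Rep.trivial R G R) →ₗ[R] R where
  toFun F := freeTriv F π w + cocycleVal F 1 1
  map_add' F F' := by
    rw [freeTriv_add, cocycleVal_add, Pi.add_apply]
    ring
  map_smul' r F := by
    rw [freeTriv_smul, cocycleVal_smul, Pi.smul_apply, smul_eq_mul, ← mul_add]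
    rfl

theorem wordEval_apply (w : FreeGroup ι) :
    wordEval π w F = freeTriv F π w + cocycleVal F 1 1 := rfl

/-- Writing a relator as an equation `w = w'` between words avoids computing lifts of inverses. -/
theorem wordEval_mul_inv {w w' : FreeGroup ι} (hw : π w = π w') :
    wordEval π (w * w'⁻¹) F = freeTriv F π w - freeTriv F π w' := by
  have h1 := freeTriv_mul F π (w * w'⁻¹) w'
  rw [inv_mul_cancel_right, map_mul, map_inv, hw, mul_inv_cancel, cocycleVal_one_left] at h1
  rw [h1, wordEval_apply]
  ring

theorem freeTriv_zpow_eq_zero (w : FreeGroup ι) (hw : freeTriv F π w = 0)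
    (hF : ∀ n : ℤ, cocycleVal F (π w ^ n) (π w) = 0) (n : ℤ) : freeTriv F π (w ^ n) = 0 := by
  have key : ∀ n : ℤ, freeTriv F π (w ^ (n + 1)) = freeTriv F π (w ^ n) := fun n => by
    rw [zpow_add_one, freeTriv_mul, hw, map_zpow, hF]
    ring
  -- The case `n = 0` of `hF` forces `F` to be normalized.
  have h0 : freeTriv F π (w ^ (0 : ℤ)) = 0 := by
    have := hF 0
    rw [zpow_zero, cocycleVal_one_left] at this
    rw [zpow_zero, freeTriv_one, this, neg_zero]
  induction n with
  | zero => exact h0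
  | succ n ih => rw [key, ih]
  | pred n ih => rw [← ih, ← key, sub_add_cancel]

/-- If the values of a 2-cocycle of a presented group on the relators are those of a homomorphism
of the free group, then the 2-cocycle is the defect of additivity of a function that is
prescribed on the generators. -/
theorem exists_trivialization_of_wordEval {rels : Set (FreeGroup ι)}
    (F : cocycles₂ (Rep.trivial R (PresentedGroup rels) R)) (l : FreeGroup ι →* Multiplicative R)
    (hl : ∀ r ∈ rels, wordEval (PresentedGroup.mk rels) r F = (l r).toAdd) :
    ∃ c : PresentedGroup rels → R, (∀ a b, c (a * b) = c a + c b + cocycleVal F a b) ∧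
      ∀ i, c (PresentedGroup.of i) = - (l (FreeGroup.of i)).toAdd := by
  -- Shifting the lifts of the generators by `-l` cancels the values on the relators, so `t`
  -- descends to a section of the extension; its coefficient is the required function.
  set t := extensionLift F (PresentedGroup.mk rels) (fun i => - (l (FreeGroup.of i)).toAdd) with ht
  have hlift : ∀ w, (t w).coeff = freeTriv F (PresentedGroup.mk rels) w - (l w).toAdd := by
    intro w
    have := eq_freeTriv F (PresentedGroup.mk rels) (u := fun w => (t w).coeff + (l w).toAdd)
      (fun i => by simp [ht, extensionLift])
      (fun w w' => by
        simp only [ht, map_mul, CocycleExtension.coeff_mul, base_extensionLift, toAdd_mul]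
        ring)
    rw [← this]
    ring
  have hrel : ∀ r ∈ rels, t r = 1 := by
    intro r hr
    ext
    · have h1 := hl r hr
      rw [wordEval_apply] at h1
      rw [hlift, CocycleExtension.coeff_one]
      linear_combination h1
    · rw [base_extensionLift, PresentedGroup.one_of_mem hr, CocycleExtension.base_one]
  let s : PresentedGroup rels →* CocycleExtension F := PresentedGroup.toGroup hrel
  have hof : ∀ i, s (PresentedGroup.of i) = ⟨- (l (FreeGroup.of i)).toAdd, PresentedGroup.of i⟩ :=
    fun i => PresentedGroup.toGroup.of hrel
  have hs : (CocycleExtension.proj F).comp s = MonoidHom.id _ := by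
    refine PresentedGroup.ext fun i => ?_
    change (s (PresentedGroup.of i)).base = PresentedGroup.of i
    rw [hof]
  have hb : ∀ a, (s a).base = a := fun a => DFunLike.congr_fun hs a
  refine ⟨fun a => (s a).coeff, fun a b => ?_, fun i => ?_⟩
  · change (s (a * b)).coeff = _
    rw [map_mul, CocycleExtension.coeff_mul, hb, hb]
  · change (s _).coeff = _
    rw [hof]

/-- A 2-cocycle of a presented group is a coboundary if and only if its values on the relators
are those of a homomorphism of the free group. -/
theorem H2π_eq_zero_iff_wordEval {rels : Set (FreeGroup ι)}
    (F : cocycles₂ (Rep.trivial R (PresentedGroup rels) R)) :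
    (H2π (Rep.trivial R (PresentedGroup rels) R)).hom F = 0 ↔
      ∃ l : FreeGroup ι →* Multiplicative R, ∀ r ∈ rels,
        wordEval (PresentedGroup.mk rels) r F = (l r).toAdd := by
  rw [H2π_eq_zero_iff_exists]
  constructor
  · rintro ⟨c, hc⟩
    obtain ⟨l, hl⟩ := exists_hom_of_trivializations F (PresentedGroup.mk rels)
      (u := freeTriv F (PresentedGroup.mk rels)) (v := fun w => c (PresentedGroup.mk rels w))
      (freeTriv_mul F _) (fun w w' => by rw [map_mul, hc])
    refine ⟨l, fun r hr => ?_⟩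
    have h1 := hc 1 1
    rw [mul_one] at h1
    rw [wordEval_apply, hl, PresentedGroup.one_of_mem hr]
    linear_combination -h1
  · rintro ⟨l, hl⟩
    obtain ⟨c, hc, -⟩ := exists_trivialization_of_wordEval F l hl
    exact ⟨c, hc⟩

end Trivialization

/-! ### Relator values for `Γ` and the computation of its second cohomology. -/

section GammaEval

variable {R : Type} [CommRing R] (q : ℤ)

/-- The generators of the group, written multiplicatively. -/
abbrev gamma (i : Fin 3) : Gamma q := PresentedGroup.of i

/-- The quotient map from the free group. -/
abbrev gammaMk : FreeGroup (Fin 3) →* Gamma q := PresentedGroup.mk (relators q)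

/-- The relator `[x, y] z^{-q}`. -/
def relatorXY : FreeGroup (Fin 3) :=
  FreeGroup.of 0 * FreeGroup.of 1 * (FreeGroup.of 0)⁻¹ * (FreeGroup.of 1)⁻¹ * (FreeGroup.of 2 ^ q)⁻¹

/-- The relator `[z, x]`, for `i = 0`, or `[z, y]`, for `i = 1`. -/
def relatorZ (i : Fin 3) : FreeGroup (Fin 3) :=
  FreeGroup.of 2 * FreeGroup.of i * (FreeGroup.of i * FreeGroup.of 2)⁻¹

theorem forall_mem_relators {P : FreeGroup (Fin 3) → Prop} :
    (∀ r ∈ relators q, P r) ↔ P (relatorXY q) ∧ P (relatorZ 0) ∧ P (relatorZ 1) := by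
  simp [relators, relatorXY, relatorZ]

theorem relatorXY_eq : relatorXY q = FreeGroup.of 0 * FreeGroup.of 1 *
    (FreeGroup.of 2 ^ q * (FreeGroup.of 1 * FreeGroup.of 0))⁻¹ := by
  simp only [relatorXY, mul_inv_rev, mul_assoc]

theorem gammaMk_relators : gammaMk q (relatorXY q) = 1 ∧ gammaMk q (relatorZ 0) = 1 ∧
    gammaMk q (relatorZ 1) = 1 :=
  (forall_mem_relators q (P := fun r => gammaMk q r = 1)).1
    fun _ hr => PresentedGroup.one_of_mem hr

/-- The hypothesis makes the chosen lift multiplicative on powers of `z`, so `z ^ q` contributes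
nothing by itself. -/
theorem wordEval_relatorXY (F : cocycles₂ (Rep.trivial R (Gamma q) R))
    (hF : ∀ n : ℤ, cocycleVal F (gamma q 2 ^ n) (gamma q 2) = 0) :
    wordEval (gammaMk q) (relatorXY q) F = cocycleVal F (gamma q 0) (gamma q 1) -
      cocycleVal F (gamma q 1) (gamma q 0) -
      cocycleVal F (gamma q 2 ^ q) (gamma q 1 * gamma q 0) := by
  have h1 := (gammaMk_relators q).1
  rw [relatorXY_eq, map_mul, map_inv, mul_inv_eq_one] at h1
  rw [relatorXY_eq, wordEval_mul_inv _ _ h1]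
  simp only [freeTriv_mul, freeTriv_of, map_mul, map_zpow]
  rw [freeTriv_zpow_eq_zero F (gammaMk q) (FreeGroup.of 2) (freeTriv_of _ _ _) hF]
  change 0 + 0 + cocycleVal F (gamma q 0) (gamma q 1) - (0 + (0 + 0 +
    cocycleVal F (gamma q 1) (gamma q 0)) +
      cocycleVal F (gamma q 2 ^ q) (gamma q 1 * gamma q 0)) = _
  ring

theorem wordEval_relatorZ (F : cocycles₂ (Rep.trivial R (Gamma q) R)) {i : Fin 3}
    (hi : gammaMk q (relatorZ i) = 1) :
    wordEval (gammaMk q) (relatorZ i) F =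
      cocycleVal F (gamma q 2) (gamma q i) - cocycleVal F (gamma q i) (gamma q 2) := by
  rw [relatorZ, map_mul, map_inv, mul_inv_eq_one] at hi
  rw [relatorZ, wordEval_mul_inv _ _ hi]
  simp only [freeTriv_mul, freeTriv_of]
  change 0 + 0 + cocycleVal F (gamma q 2) (gamma q i) -
    (0 + 0 + cocycleVal F (gamma q i) (gamma q 2)) = _
  ring

theorem toAdd_relatorXY (l : FreeGroup (Fin 3) →* Multiplicative R) :
    (l (relatorXY q)).toAdd = - (q * (l (FreeGroup.of 2)).toAdd) := by
  simp [relatorXY]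

theorem toAdd_relatorZ (l : FreeGroup (Fin 3) →* Multiplicative R) (i : Fin 3) :
    (l (relatorZ i)).toAdd = 0 := by
  simp only [relatorZ, map_mul, map_inv, toAdd_mul, toAdd_inv]
  ring

/-- A 2-cocycle of `Γ` is a coboundary if and only if it vanishes on the relators `[z, x]` and
`[z, y]` and its value on `[x, y] z^{-q}` is divisible by `q`. -/
theorem gamma_H2π_eq_zero_iff (F : cocycles₂ (Rep.trivial R (Gamma q) R)) :
    (H2π (Rep.trivial R (Gamma q) R)).hom F = 0 ↔
      wordEval (gammaMk q) (relatorZ 0) F = 0 ∧ wordEval (gammaMk q) (relatorZ 1) F = 0 ∧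
        (q : R) ∣ wordEval (gammaMk q) (relatorXY q) F := by
  rw [H2π_eq_zero_iff_wordEval]
  simp only [forall_mem_relators q, toAdd_relatorXY, toAdd_relatorZ]
  constructor
  · rintro ⟨l, h1, h2, h3⟩
    exact ⟨h2, h3, - (l (FreeGroup.of 2)).toAdd, by rw [h1, mul_neg]⟩
  · rintro ⟨h2, h3, t, ht⟩
    -- Only the value at `z` matters; `-t` there gives `q * t` on `[x, y] z^{-q}`.
    refine ⟨FreeGroup.lift fun _ => Multiplicative.ofAdd (-t), ?_, h2, h3⟩
    rw [ht, FreeGroup.lift_apply_of]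
    simp

/-! ### Explicit cocycles -/

theorem f_gamma (i : Fin 3) : f q (Additive.ofMul (gamma q i)) = (![1, 0, 0] : Fin 3 → ℤ) i :=
  homOfValues_gen q _ _ i

theorem g_gamma (i : Fin 3) : g q (Additive.ofMul (gamma q i)) = (![0, 1, 0] : Fin 3 → ℤ) i :=
  homOfValues_gen q _ _ i

theorem cocycleVal_cupCocycle {G : Type} [Group G] (φ ψ : Additive G →+ R) (a b : G) :
    cocycleVal (cupCocycle φ ψ) a b = φ (Additive.ofMul a) * ψ (Additive.ofMul b) := rfl

/-- The cocycle `f ∪ g` has value 1 on `[x, y] z^{-q}` and 0 on the other relators. Hence `q (f ∪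
g)` has the relator values of the homomorphism `z ↦ -1`, `x, y ↦ 0`, and is a coboundary. -/
theorem exists_heisCoord : ∃ c : Gamma q → ℤ,
    (∀ a b, c (a * b) = c a + c b + q * (f q (Additive.ofMul a) * g q (Additive.ofMul b))) ∧
      ∀ i, c (gamma q i) = (![0, 0, 1] : Fin 3 → ℤ) i := by
  obtain ⟨c, hc, hv⟩ := exists_trivialization_of_wordEval
    (q • cupCocycle (f q) (g q) : cocycles₂ (Rep.trivial ℤ (Gamma q) ℤ))
    (FreeGroup.lift fun i => Multiplicative.ofAdd (-(![0, 0, 1] : Fin 3 → ℤ) i)) (by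
      rw [forall_mem_relators]
      refine ⟨?_, ?_, ?_⟩
      · rw [toAdd_relatorXY, map_smul, wordEval_relatorXY]
        · simp only [cocycleVal_cupCocycle, ofMul_zpow, map_zsmul, f_gamma, g_gamma]
          simp
        · intro n
          simp only [cocycleVal_cupCocycle, g_gamma]
          simp
      · rw [toAdd_relatorZ, map_smul, wordEval_relatorZ _ _ (gammaMk_relators q).2.1]
        simp only [cocycleVal_cupCocycle, f_gamma, g_gamma]
        simp
      · rw [toAdd_relatorZ, map_smul, wordEval_relatorZ _ _ (gammaMk_relators q).2.2]
        simp only [cocycleVal_cupCocycle, f_gamma, g_gamma]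
        simp)
  exact ⟨c, hc, fun i => by simp [hv]⟩

/-- The exponent of `z` in the normal form `y ^ b * x ^ a * z ^ c`. -/
def heisCoord : Gamma q → ℤ := (exists_heisCoord q).choose

theorem heisCoord_mul (a b : Gamma q) : heisCoord q (a * b) = heisCoord q a + heisCoord q b +
    q * (f q (Additive.ofMul a) * g q (Additive.ofMul b)) :=
  (exists_heisCoord q).choose_spec.1 a b

theorem heisCoord_gamma (i : Fin 3) : heisCoord q (gamma q i) = (![0, 0, 1] : Fin 3 → ℤ) i :=
  (exists_heisCoord q).choose_spec.2 i

theorem heisCoord_zpow (n : ℤ) : heisCoord q (gamma q 2 ^ n) = n := by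
  have key : ∀ n : ℤ, heisCoord q (gamma q 2 ^ (n + 1)) = heisCoord q (gamma q 2 ^ n) + 1 :=
    fun n => by
      rw [zpow_add_one, heisCoord_mul, heisCoord_gamma, g_gamma]
      simp
  induction n with
  | zero =>
    have := heisCoord_mul q 1 1
    simp only [mul_one, ofMul_one, map_zero, mul_zero, add_zero] at this
    rw [zpow_zero]
    omega
  | succ n ih => rw [key, ih]
  | pred n ih =>
    have := key (-(n : ℤ) - 1)
    rw [sub_add_cancel, ih] at this
    omega

/-- The polynomial `t (t - 1) / 2`. -/
def intChooseTwo (t : ℤ) : ℤ := t * (t - 1) / 2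

/-- The defect `t * u` is what cancels the terms `q f f g` and `q f g g` that `heisCoord_mul`
produces in the cocycle identities for `fhCocycle` and `hgCocycle`. -/
theorem intChooseTwo_add (t u : ℤ) :
    intChooseTwo (t + u) = intChooseTwo t + intChooseTwo u + t * u := by
  obtain ⟨m, hm⟩ := (Int.even_mul_pred_self t).two_dvd
  obtain ⟨n, hn⟩ := (Int.even_mul_pred_self u).two_dvd
  have hmn : (t + u) * (t + u - 1) = 2 * (m + n + t * u) := by linear_combination hm + hn
  simp only [intChooseTwo, hmn, hm, hn]
  omega

/-- The 2-cocycle defined by a function of two variables. -/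
def mkCocycle {G : Type} [Group G] (u : G → G → R)
    (hu : ∀ a b c, u (a * b) c + u a b = u b c + u a (b * c)) : cocycles₂ (Rep.trivial R G R) :=
  ⟨fun ab : G × G => u ab.1 ab.2, (mem_cocycles₂_iff (A := Rep.trivial R G R) _).2 hu⟩

/-- An integral 2-cocycle that is congruent to `f ∪ h` modulo every divisor of `q`. -/
def fhCocycle : cocycles₂ (Rep.trivial ℤ (Gamma q) ℤ) :=
  mkCocycle (fun a b => f q (Additive.ofMul a) * heisCoord q b +
    q * intChooseTwo (f q (Additive.ofMul a)) * g q (Additive.ofMul b)) fun a b c => by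
      simp only [ofMul_mul, map_add, heisCoord_mul, intChooseTwo_add]
      ring

/-- An integral 2-cocycle that is congruent to `h ∪ g` modulo every divisor of `q`. -/
def hgCocycle : cocycles₂ (Rep.trivial ℤ (Gamma q) ℤ) :=
  mkCocycle (fun a b => heisCoord q a * g q (Additive.ofMul b) +
    q * f q (Additive.ofMul a) * intChooseTwo (g q (Additive.ofMul b))) fun a b c => by
      simp only [ofMul_mul, map_add, heisCoord_mul, intChooseTwo_add]
      ring

theorem cocycleVal_fhCocycle (a b : Gamma q) : cocycleVal (fhCocycle q) a b =
    f q (Additive.ofMul a) * heisCoord q b +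
      q * intChooseTwo (f q (Additive.ofMul a)) * g q (Additive.ofMul b) := rfl

theorem cocycleVal_hgCocycle (a b : Gamma q) : cocycleVal (hgCocycle q) a b =
    heisCoord q a * g q (Additive.ofMul b) +
      q * f q (Additive.ofMul a) * intChooseTwo (g q (Additive.ofMul b)) := rfl

theorem cocycleVal_coeffCocycle {S G : Type} [CommRing S] [Group G] (ρ : R →+* S)
    (F : cocycles₂ (Rep.trivial R G R)) (a b : G) :
    cocycleVal (coeffCocycle ρ G F) a b = ρ (cocycleVal F a b) := rfl

/-! ### The second cohomology group -/

variable (R) in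
/-- The values of a 2-cocycle of `Γ` on the relators, the last of them modulo `q`. -/
def relatorEval : cocycles₂ (Rep.trivial R (Gamma q) R) →ₗ[R] (R × R) × (R ⧸ Ideal.span {(q : R)}) :=
  -- The sign makes the first coordinate of `fhCocycle` equal to `1`: that cocycle pairs `x` with
  -- `z`, in this order.
  ((-wordEval (gammaMk q) (relatorZ 0)).prod (wordEval (gammaMk q) (relatorZ 1))).prod
    ((Ideal.span {(q : R)}).mkQ ∘ₗ wordEval (gammaMk q) (relatorXY q))

theorem relatorEval_apply (F : cocycles₂ (Rep.trivial R (Gamma q) R)) :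
    relatorEval R q F = ((-wordEval (gammaMk q) (relatorZ 0) F, wordEval (gammaMk q) (relatorZ 1) F),
      Ideal.Quotient.mk _ (wordEval (gammaMk q) (relatorXY q) F)) := rfl

theorem ker_relatorEval :
    LinearMap.ker (relatorEval R q) = LinearMap.ker (H2π (Rep.trivial R (Gamma q) R)).hom := by
  ext F
  rw [LinearMap.mem_ker, LinearMap.mem_ker, gamma_H2π_eq_zero_iff, relatorEval_apply]
  simp only [Prod.mk_eq_zero, neg_eq_zero, Ideal.Quotient.eq_zero_iff_dvd, and_assoc]

theorem relatorEval_fh : relatorEval R q (coeffCocycle (Int.castRingHom R) _ (fhCocycle q)) =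
    ((1, 0), 0) := by
  rw [relatorEval_apply, wordEval_relatorXY, wordEval_relatorZ _ _ (gammaMk_relators q).2.1,
    wordEval_relatorZ _ _ (gammaMk_relators q).2.2]
  · simp only [cocycleVal_coeffCocycle, cocycleVal_fhCocycle, ofMul_zpow, map_zsmul, f_gamma,
      g_gamma, heisCoord_gamma, ofMul_mul, map_add]
    simp [intChooseTwo]
  · intro n
    simp only [cocycleVal_coeffCocycle, cocycleVal_fhCocycle, ofMul_zpow, map_zsmul, f_gamma,
      g_gamma]
    simp

theorem relatorEval_hg : relatorEval R q (coeffCocycle (Int.castRingHom R) _ (hgCocycle q)) =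
    ((0, 1), 0) := by
  rw [relatorEval_apply, wordEval_relatorXY, wordEval_relatorZ _ _ (gammaMk_relators q).2.1,
    wordEval_relatorZ _ _ (gammaMk_relators q).2.2]
  · simp only [cocycleVal_coeffCocycle, cocycleVal_hgCocycle, ofMul_zpow, map_zsmul, f_gamma,
      g_gamma, heisCoord_gamma, heisCoord_zpow, ofMul_mul, map_add]
    -- The value on `[x, y] z^{-q}` is `-q`, from the pair `(z ^ q, y x)`; it vanishes only in the
    -- quotient.
    have hq : ((q : ℤ) : R ⧸ Ideal.span {(q : R)}) = 0 := by
      rw [← map_intCast (Ideal.Quotient.mk (Ideal.span {(q : R)})), Ideal.Quotient.eq_zero_iff_dvd]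
    simp [intChooseTwo, hq]
  · intro n
    simp only [cocycleVal_coeffCocycle, cocycleVal_hgCocycle, ofMul_zpow, map_zsmul, f_gamma,
      g_gamma]
    simp [intChooseTwo]

theorem relatorEval_fg :
    relatorEval R q (coeffCocycle (Int.castRingHom R) _ (cupCocycle (f q) (g q))) =
      ((0, 0), 1) := by
  rw [relatorEval_apply, wordEval_relatorXY, wordEval_relatorZ _ _ (gammaMk_relators q).2.1,
    wordEval_relatorZ _ _ (gammaMk_relators q).2.2]
  · simp only [cocycleVal_coeffCocycle, cocycleVal_cupCocycle, ofMul_zpow, map_zsmul, f_gamma,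
      g_gamma]
    simp
  · intro n
    simp only [cocycleVal_coeffCocycle, cocycleVal_cupCocycle, ofMul_zpow, map_zsmul, f_gamma,
      g_gamma]
    simp

theorem relatorEval_surjective : Function.Surjective (relatorEval R q) := by
  rintro ⟨⟨r, s⟩, t⟩
  obtain ⟨t, rfl⟩ := Ideal.Quotient.mk_surjective t
  refine ⟨r • coeffCocycle (Int.castRingHom R) _ (fhCocycle q) +
    s • coeffCocycle (Int.castRingHom R) _ (hgCocycle q) +
    t • coeffCocycle (Int.castRingHom R) _ (cupCocycle (f q) (g q)), ?_⟩
  simp only [map_add, map_smul, relatorEval_fh, relatorEval_hg, relatorEval_fg]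
  simp [Algebra.smul_def]

variable (R) in
/-- The isomorphism `H²(Γ; R) ≅ R² ⊕ R/q`. -/
def h2Equiv : HTwo R (Gamma q) ≃ₗ[R] (R × R) × (R ⧸ Ideal.span {(q : R)}) :=
  ((H2π (Rep.trivial R (Gamma q) R)).hom.quotKerEquivOfSurjective
      (H2π_surjective (R := R) (Gamma q))).symm ≪≫ₗ
    Submodule.quotEquivOfEq _ _ (ker_relatorEval q).symm ≪≫ₗ
    (relatorEval R q).quotKerEquivOfSurjective (relatorEval_surjective q)

theorem h2Equiv_H2π (F : cocycles₂ (Rep.trivial R (Gamma q) R)) :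
    h2Equiv R q ((H2π (Rep.trivial R (Gamma q) R)).hom F) = relatorEval R q F := by
  have : ((H2π (Rep.trivial R (Gamma q) R)).hom.quotKerEquivOfSurjective
      (H2π_surjective (R := R) (Gamma q))).symm ((H2π (Rep.trivial R (Gamma q) R)).hom F) =
        Submodule.Quotient.mk F := by
    rw [LinearEquiv.symm_apply_eq]
    rfl
  simp only [h2Equiv, LinearEquiv.trans_apply, this]
  rfl

/-- The class of an integral cocycle congruent to `f ∪ h` modulo every divisor of `q`. -/
def fhClass : HTwo ℤ (Gamma q) := (H2π (Rep.trivial ℤ (Gamma q) ℤ)).hom (fhCocycle q)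

/-- The class of an integral cocycle congruent to `h ∪ g` modulo every divisor of `q`. -/
def hgClass : HTwo ℤ (Gamma q) := (H2π (Rep.trivial ℤ (Gamma q) ℤ)).hom (hgCocycle q)

/-- The cup product of `f` and `g`. -/
def fgClass : HTwo ℤ (Gamma q) := cup ℤ _ (homClass (f q)) (homClass (g q))

theorem fgClass_eq : fgClass q =
    (H2π (Rep.trivial ℤ (Gamma q) ℤ)).hom (cupCocycle (f q) (g q)) := by
  rw [fgClass, cup_apply, homEquiv_homClass, homEquiv_homClass]

/-- The same integral classes give the standard generators over every `R`, so changes of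
coefficients from `ℤ` are visible in coordinates. -/
theorem h2Equiv_fh : h2Equiv R q (coeffMap (Int.castRingHom R) _ (fhClass q)) = ((1, 0), 0) := by
  rw [fhClass, coeffMap_H2π, h2Equiv_H2π, relatorEval_fh]

theorem h2Equiv_hg : h2Equiv R q (coeffMap (Int.castRingHom R) _ (hgClass q)) = ((0, 1), 0) := by
  rw [hgClass, coeffMap_H2π, h2Equiv_H2π, relatorEval_hg]

theorem h2Equiv_fg : h2Equiv R q (coeffMap (Int.castRingHom R) _ (fgClass q)) = ((0, 0), 1) := by
  rw [fgClass_eq, coeffMap_H2π, h2Equiv_H2π, relatorEval_fg]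

theorem coeffMap_int {G : Type} [Group G] (u : HTwo ℤ G) :
    coeffMap (Int.castRingHom ℤ) G u = u := by
  obtain ⟨F, rfl⟩ := H2π_surjective (R := ℤ) G u
  rw [coeffMap_H2π]
  congr 1

theorem h2Equiv_fhClass : h2Equiv ℤ q (fhClass q) = ((1, 0), 0) := by
  rw [← h2Equiv_fh, coeffMap_int]

theorem h2Equiv_hgClass : h2Equiv ℤ q (hgClass q) = ((0, 1), 0) := by
  rw [← h2Equiv_hg, coeffMap_int]

end GammaEval

/-! ### Homomorphisms on `Γ`, their cup products, and the separate claims. -/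

section GammaCup

variable {R : Type} [CommRing R] (q : ℤ)

theorem gamma_hom_ext {A : Type} [AddCommGroup A] {φ ψ : Additive (Gamma q) →+ A}
    (hφ : ∀ i, φ (gen q i) = ψ (gen q i)) : φ = ψ := by
  have : AddMonoidHom.toMultiplicativeRight φ = AddMonoidHom.toMultiplicativeRight ψ :=
    PresentedGroup.ext hφ
  exact AddMonoidHom.toMultiplicativeRight.injective this

theorem f_gen (i : Fin 3) : f q (gen q i) = (![1, 0, 0] : Fin 3 → ℤ) i := homOfValues_gen q _ _ i

theorem g_gen (i : Fin 3) : g q (gen q i) = (![0, 1, 0] : Fin 3 → ℤ) i := homOfValues_gen q _ _ i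

theorem h_gen (p : ℕ) (hpq : (p : ℤ) ∣ q) (i : Fin 3) :
    h q p hpq (gen q i) = (![0, 0, 1] : Fin 3 → ZMod p) i :=
  homOfValues_gen q _ _ i

theorem modp_apply {G : Type} [Group G] (p : ℕ) (φ : Additive G →+ ℤ) (a : Additive G) :
    modp p φ a = (φ a : ZMod p) := rfl

/-- The commutator `[x, y] = z ^ q` dies in an abelian group. -/
theorem zsmul_gamma_hom_gen_two {A : Type} [AddCommGroup A] (φ : Additive (Gamma q) →+ A) :
    q • φ (gen q 2) = 0 := by
  have h1 := (gammaMk_relators q).1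
  have h2 := congrArg (AddMonoidHom.toMultiplicativeRight φ) h1
  rw [map_one, relatorXY] at h2
  have h3 := congrArg Multiplicative.toAdd h2
  simp only [map_mul, map_inv, map_zpow, toAdd_mul, toAdd_inv, toAdd_zpow, toAdd_one] at h3
  have h4 : ∀ a b c : A, a + b + -a + -b + -(q • c) = 0 → q • c = 0 := fun a b c habc => by
    rwa [show a + b + -a + -b + -(q • c) = -(q • c) by abel, neg_eq_zero] at habc
  exact h4 _ _ _ h3

theorem gamma_hom_gen_two [IsDomain R] [CharZero R] (hq : q ≠ 0) (φ : Additive (Gamma q) →+ R) :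
    φ (gen q 2) = 0 := by
  have := zsmul_gamma_hom_gen_two q φ
  rw [zsmul_eq_mul] at this
  exact (mul_eq_zero.1 this).resolve_left (Int.cast_ne_zero.2 hq)

theorem cup_swap {G : Type} [Group G] (halt : ∀ a : HOne R G, cup R G a a = 0)
    (a b : HOne R G) : cup R G a b = - cup R G b a := by
  have := halt (a + b)
  simp only [map_add, LinearMap.add_apply, halt, zero_add, add_zero] at this
  exact eq_neg_of_add_eq_zero_right this

/-- In characteristic zero, all cup products of degree one classes are multiples of `f ∪ g`. -/
theorem exists_cup_eq_smul [IsDomain R] [CharZero R] (hq : q ≠ 0)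
    (halt : ∀ a : HOne R (Gamma q), cup R _ a a = 0) (a b : HOne R (Gamma q)) :
    ∃ n : R, cup R _ a b = n • coeffMap (Int.castRingHom R) _ (fgClass q) := by
  set F := homClass ((Int.castRingHom R).toAddMonoidHom.comp (f q)) with hF
  set G := homClass ((Int.castRingHom R).toAddMonoidHom.comp (g q)) with hG
  have key : ∀ a : HOne R (Gamma q), ∃ r s : R, a = r • F + s • G := by
    intro a
    refine ⟨homEquiv R _ a (gen q 0), homEquiv R _ a (gen q 1), (homEquiv R _).injective ?_⟩
    rw [map_add, map_smul, map_smul, hF, hG, homEquiv_homClass, homEquiv_homClass]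
    refine gamma_hom_ext q fun i => ?_
    change _ = homEquiv R _ a (gen q 0) * ((f q (gen q i) : ℤ) : R) +
      homEquiv R _ a (gen q 1) * ((g q (gen q i) : ℤ) : R)
    rw [f_gen, g_gen]
    fin_cases i
    · simp
    · simp
    · simpa using gamma_hom_gen_two q hq (homEquiv R _ a)
  obtain ⟨r, s, ha⟩ := key a
  obtain ⟨r', s', hb⟩ := key b
  -- The determinant of the coordinates, since the cup product is alternating.
  refine ⟨r * s' - s * r', ?_⟩
  rw [fgClass, coeffMap_cup, ← hF, ← hG, ha, hb]
  simp only [map_add, map_smul, LinearMap.add_apply, LinearMap.smul_apply, halt, smul_zero,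
    zero_add, add_zero, cup_swap halt G F]
  module

theorem exists_eq_combination (u : HTwo R (Gamma q)) : ∃ r s t : R,
    u = r • coeffMap (Int.castRingHom R) _ (fhClass q) +
      s • coeffMap (Int.castRingHom R) _ (hgClass q) +
      t • coeffMap (Int.castRingHom R) _ (fgClass q) := by
  obtain ⟨⟨⟨r, s⟩, t⟩, hu⟩ : ∃ v, h2Equiv R q u = v := ⟨_, rfl⟩
  obtain ⟨t, rfl⟩ := Ideal.Quotient.mk_surjective t
  refine ⟨r, s, t, (h2Equiv R q).injective ?_⟩
  simp only [map_add, map_smul, h2Equiv_fh, h2Equiv_hg, h2Equiv_fg, hu]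
  simp [Algebra.smul_def]

theorem h2Equiv_combination (r s t : R) : h2Equiv R q
    (r • coeffMap (Int.castRingHom R) _ (fhClass q) +
      s • coeffMap (Int.castRingHom R) _ (hgClass q) +
      t • coeffMap (Int.castRingHom R) _ (fgClass q)) = ((r, s), Ideal.Quotient.mk _ t) := by
  simp only [map_add, map_smul, h2Equiv_fh, h2Equiv_hg, h2Equiv_fg]
  simp [Algebra.smul_def]

/-- The integer `q` is a unit in `K`, so the summand `K/q` is zero. -/
theorem coeffMap_fgClass_eq_zero (K : Type) [Field K] [CharZero K] (hq : q ≠ 0) :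
    coeffMap (Int.castRingHom K) _ (fgClass q) = 0 := by
  refine (h2Equiv K q).injective ?_
  rw [h2Equiv_fg, map_zero, Prod.mk_eq_zero]
  refine ⟨rfl, ?_⟩
  rw [← map_one (Ideal.Quotient.mk _), Ideal.Quotient.eq_zero_iff_dvd]
  exact (IsUnit.mk0 _ (Int.cast_ne_zero.2 hq)).dvd

/-- Homomorphisms from `Γ` to a domain of characteristic zero. -/
def charZeroHomEquiv [IsDomain R] [CharZero R] (hq : q ≠ 0) :
    (Additive (Gamma q) →+ R) ≃ₗ[R] R × R where
  toFun φ := (φ (gen q 0), φ (gen q 1))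
  map_add' _ _ := rfl
  map_smul' _ _ := rfl
  invFun v := homOfValues q ![v.1, v.2, 0] (by simp)
  left_inv φ := by
    refine gamma_hom_ext q fun i => ?_
    rw [homOfValues_gen]
    fin_cases i
    · rfl
    · rfl
    · exact (gamma_hom_gen_two q hq φ).symm
  right_inv v := by
    simp only [homOfValues_gen]
    rfl

/-- Homomorphisms from `Γ` to a ring in which `q = 0`. -/
def torsionHomEquiv (hq : (q : R) = 0) : (Additive (Gamma q) →+ R) ≃ₗ[R] (Fin 3 → R) where
  toFun φ i := φ (gen q i)
  map_add' _ _ := rfl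
  map_smul' _ _ := rfl
  invFun v := homOfValues q v (by rw [zsmul_eq_mul, hq, zero_mul])
  left_inv φ := gamma_hom_ext q fun i => homOfValues_gen q _ _ i
  right_inv v := funext fun i => homOfValues_gen q _ _ i

theorem finrank_HOne_charZero (K : Type) [Field K] [CharZero K] (hq : q ≠ 0) :
    Module.finrank K (HOne K (Gamma q)) = 2 := by
  rw [(homEquiv K (Gamma q) ≪≫ₗ charZeroHomEquiv q hq).finrank_eq, Module.finrank_prod,
    Module.finrank_self]

theorem wedgeCup_eq_zero {G : Type} [Group G] (halt : ∀ a : HOne R G, cup R G a a = 0)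
    (h0 : ∀ a b, cup R G a b = 0) : wedgeCup R G halt = 0 := by
  refine exteriorPower.linearMap_ext (AlternatingMap.ext fun v => ?_)
  have hv : v = ![v 0, v 1] := by
    funext i
    fin_cases i <;> rfl
  change wedgeCup R G halt (exteriorPower.ιMulti R 2 v) = 0
  rw [hv, wedgeCup_ιMulti, h0]

/-! ### Integral cohomology -/

theorem exists_eq_combination_int (u : HTwo ℤ (Gamma q)) : ∃ r s t : ℤ,
    u = r • fhClass q + s • hgClass q + t • fgClass q := by
  obtain ⟨r, s, t, hu⟩ := exists_eq_combination q u
  simp only [coeffMap_int] at hu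
  exact ⟨r, s, t, by simpa only [← Int.cast_smul_eq_zsmul ℤ, Int.cast_id] using hu⟩

theorem h2Equiv_combination_int (r s t : ℤ) :
    h2Equiv ℤ q (r • fhClass q + s • hgClass q + t • fgClass q) =
      ((r, s), Ideal.Quotient.mk _ t) := by
  have := h2Equiv_combination (R := ℤ) q r s t
  simpa only [coeffMap_int, ← Int.cast_smul_eq_zsmul ℤ, Int.cast_id] using this

theorem nonempty_HTwo_int_equiv :
    Nonempty (HTwo ℤ (Gamma q) ≃+ (ℤ × ℤ) × ZMod q.natAbs) := by
  have e := (h2Equiv ℤ q).toAddEquiv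
  rw [Int.cast_id] at e
  exact ⟨e.trans (AddEquiv.prodCongr (AddEquiv.refl _) (Int.quotientSpanEquivZMod q).toAddEquiv)⟩

theorem fgClass_mem_torsion (hq : q ≠ 0) :
    fgClass q ∈ AddCommGroup.torsion (HTwo ℤ (Gamma q)) := by
  rw [AddCommGroup.mem_torsion, isOfFinAddOrder_iff_zsmul_eq_zero]
  refine ⟨q, hq, (h2Equiv ℤ q).injective ?_⟩
  have := h2Equiv_combination_int q 0 0 q
  rw [zero_smul, zero_smul, zero_add, zero_add] at this
  rw [this, map_zero, Prod.mk_eq_zero, Ideal.Quotient.eq_zero_iff_dvd]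
  exact ⟨rfl, dvd_of_eq (Int.cast_id)⟩

/-- The coordinates in `ℤ²` of a torsion class vanish, which leaves a multiple of `f ∪ g`. -/
theorem torsion_HTwo_int (hq : q ≠ 0) :
    AddCommGroup.torsion (HTwo ℤ (Gamma q)) = AddSubgroup.zmultiples (fgClass q) := by
  refine le_antisymm (fun u hu => ?_)
    (AddSubgroup.zmultiples_le_of_mem (fgClass_mem_torsion q hq))
  rw [AddCommGroup.mem_torsion, isOfFinAddOrder_iff_zsmul_eq_zero] at hu
  obtain ⟨n, hn, hu⟩ := hu
  obtain ⟨r, s, t, rfl⟩ := exists_eq_combination_int q u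
  have h1 := congrArg (h2Equiv ℤ q) hu
  rw [map_zsmul, h2Equiv_combination_int, map_zero, Prod.smul_mk, Prod.smul_mk, Prod.mk_eq_zero,
    Prod.mk_eq_zero, smul_eq_zero_iff_right hn, smul_eq_zero_iff_right hn] at h1
  rw [h1.1.1, h1.1.2, zero_smul, zero_smul, zero_add, zero_add]
  exact AddSubgroup.mem_zmultiples_iff.2 ⟨t, rfl⟩

theorem cup_int_mem_zmultiples (hq : q ≠ 0) (a b : HOne ℤ (Gamma q)) :
    cup ℤ _ a b ∈ AddSubgroup.zmultiples (fgClass q) := by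
  obtain ⟨n, hn⟩ := exists_cup_eq_smul q hq (cup_self_int _) a b
  rw [coeffMap_int] at hn
  refine AddSubgroup.mem_zmultiples_iff.2 ⟨n, ?_⟩
  rw [hn, ← Int.cast_smul_eq_zsmul ℤ, Int.cast_id]

/-- Order `0` encodes infinite order; the first component lies in the torsion-free group `ℤ²`. -/
theorem addOrderOf_eq_zero_of_h2Equiv {u : HTwo ℤ (Gamma q)} (hu : (h2Equiv ℤ q u).1 ≠ 0) :
    addOrderOf u = 0 := by
  rw [addOrderOf_eq_zero_iff, isOfFinAddOrder_iff_nsmul_eq_zero]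
  rintro ⟨n, hn, h0⟩
  have h1 := congrArg (fun v => (h2Equiv ℤ q v).1) h0
  simp only [map_nsmul, map_zero, Prod.smul_fst, Prod.fst_zero] at h1
  exact hu ((smul_eq_zero_iff_right hn.ne').1 h1)

/-! ### Cohomology modulo a prime divisor of `q` -/

variable (p : ℕ)

theorem intCast_zmod_eq_zero_of_dvd (hpq : (p : ℤ) ∣ q) : (q : ZMod p) = 0 :=
  (ZMod.intCast_zmod_eq_zero_iff_dvd q p).2 hpq

/-- Modulo `p` the error term `q f g` of `heisCoord` disappears, so it becomes a homomorphism, and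
homomorphisms are compared on the generators. -/
theorem h_apply (hpq : (p : ℤ) ∣ q) (a : Gamma q) : h q p hpq (Additive.ofMul a) = (heisCoord q a : ZMod p) := by
  let c : Additive (Gamma q) →+ ZMod p :=
    AddMonoidHom.mk' (fun a => (heisCoord q a.toMul : ZMod p)) fun a b => by
      rw [toMul_add, heisCoord_mul]
      push_cast
      rw [intCast_zmod_eq_zero_of_dvd q p hpq]
      ring
  have hc : h q p hpq = c := by
    refine gamma_hom_ext q fun i => ?_
    rw [h_gen]
    change _ = (heisCoord q (gamma q i) : ZMod p)
    rw [heisCoord_gamma]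
    fin_cases i <;> simp
  rw [hc]
  rfl

theorem coeffMap_fgClass : coeffMap (Int.castRingHom (ZMod p)) _ (fgClass q) =
    cup (ZMod p) _ (homClass (modp p (f q))) (homClass (modp p (g q))) :=
  coeffMap_cup _ _ _ _

theorem coeffMap_fhClass (hpq : (p : ℤ) ∣ q) : coeffMap (Int.castRingHom (ZMod p)) _ (fhClass q) =
    cup (ZMod p) _ (homClass (modp p (f q))) (homClass (h q p hpq)) := by
  rw [fhClass, coeffMap_H2π, cup_apply, homEquiv_homClass, homEquiv_homClass]
  congr 1
  refine Subtype.ext (funext fun ab => ?_)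
  change cocycleVal (coeffCocycle _ _ (fhCocycle q)) ab.1 ab.2 =
    modp p (f q) (Additive.ofMul ab.1) * h q p hpq (Additive.ofMul ab.2)
  rw [cocycleVal_coeffCocycle, cocycleVal_fhCocycle, h_apply, modp_apply]
  simp [intCast_zmod_eq_zero_of_dvd q p hpq]

theorem coeffMap_hgClass (hpq : (p : ℤ) ∣ q) : coeffMap (Int.castRingHom (ZMod p)) _ (hgClass q) =
    cup (ZMod p) _ (homClass (h q p hpq)) (homClass (modp p (g q))) := by
  rw [hgClass, coeffMap_H2π, cup_apply, homEquiv_homClass, homEquiv_homClass]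
  congr 1
  refine Subtype.ext (funext fun ab => ?_)
  change cocycleVal (coeffCocycle _ _ (hgCocycle q)) ab.1 ab.2 =
    h q p hpq (Additive.ofMul ab.1) * modp p (g q) (Additive.ofMul ab.2)
  rw [cocycleVal_coeffCocycle, cocycleVal_hgCocycle, h_apply, modp_apply]
  simp [intCast_zmod_eq_zero_of_dvd q p hpq]

/-- The sign comes from anticommutativity, obtained here from the vanishing of cup squares for odd
`p`. -/
theorem coeffMap_neg_hgClass (hpq : (p : ℤ) ∣ q) [Fact p.Prime] (hp2 : p ≠ 2) :
    coeffMap (Int.castRingHom (ZMod p)) _ (-hgClass q) =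
      cup (ZMod p) _ (homClass (modp p (g q))) (homClass (h q p hpq)) := by
  rw [map_neg, coeffMap_hgClass q p hpq, cup_swap (cup_self_field _ _ (two_ne_zero_of_odd p hp2)),
    neg_neg]

theorem quotient_mk_eq_zero_iff (hpq : (p : ℤ) ∣ q) (t : ZMod p) :
    Ideal.Quotient.mk (Ideal.span {(q : ZMod p)}) t = 0 ↔ t = 0 := by
  rw [Ideal.Quotient.eq_zero_iff_dvd, intCast_zmod_eq_zero_of_dvd q p hpq, zero_dvd_iff]

theorem coeffMap_fgClass_ne_zero (hpq : (p : ℤ) ∣ q) [Fact p.Prime] :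
    coeffMap (Int.castRingHom (ZMod p)) _ (fgClass q) ≠ 0 := by
  intro h0
  have h1 := h2Equiv_fg (R := ZMod p) q
  rw [h0, map_zero] at h1
  have h2 := (congrArg Prod.snd h1).symm
  rw [← map_one (Ideal.Quotient.mk _)] at h2
  exact one_ne_zero ((quotient_mk_eq_zero_iff q p hpq 1).1 h2)

theorem coeffMap_zmod_surjective [NeZero p] :
    Function.Surjective (coeffMap (Int.castRingHom (ZMod p)) (Gamma q)) := by
  -- Reductions of integral classes span; a scalar in `ZMod p` is lifted to its representative
  -- `c.val`.
  have key : ∀ (c : ZMod p) (u : HTwo ℤ (Gamma q)),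
      c • coeffMap (Int.castRingHom (ZMod p)) (Gamma q) u =
        coeffMap (Int.castRingHom (ZMod p)) (Gamma q) (c.val • u) := fun c u => by
    rw [map_nsmul, ← Nat.cast_smul_eq_nsmul (ZMod p), ZMod.natCast_zmod_val]
  intro u
  obtain ⟨r, s, t, rfl⟩ := exists_eq_combination q u
  exact ⟨r.val • fhClass q + s.val • hgClass q + t.val • fgClass q, by
    rw [map_add, map_add, key, key, key]⟩

theorem exists_basis_HTwo_zmod (hpq : (p : ℤ) ∣ q) [Fact p.Prime] (hp2 : p ≠ 2) :
    ∃ B : Module.Basis (Fin 3) (ZMod p) (HTwo (ZMod p) (Gamma q)),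
      B 0 = cup (ZMod p) _ (homClass (modp p (f q))) (homClass (h q p hpq)) ∧
      B 1 = cup (ZMod p) _ (homClass (modp p (g q))) (homClass (h q p hpq)) ∧
      B 2 = cup (ZMod p) _ (homClass (modp p (f q))) (homClass (modp p (g q))) := by
  let v : Fin 3 → HTwo (ZMod p) (Gamma q) :=
    ![coeffMap (Int.castRingHom (ZMod p)) _ (fhClass q),
      coeffMap (Int.castRingHom (ZMod p)) _ (-hgClass q),
      coeffMap (Int.castRingHom (ZMod p)) _ (fgClass q)]
  have hsum : ∀ c : Fin 3 → ZMod p, ∑ i, c i • v i =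
      c 0 • coeffMap (Int.castRingHom (ZMod p)) _ (fhClass q) +
      (- c 1) • coeffMap (Int.castRingHom (ZMod p)) _ (hgClass q) +
      c 2 • coeffMap (Int.castRingHom (ZMod p)) _ (fgClass q) := fun c => by
    simp [Fin.sum_univ_three, v]
  have hli : LinearIndependent (ZMod p) v := by
    rw [Fintype.linearIndependent_iff]
    intro c hc
    rw [hsum] at hc
    have h1 := h2Equiv_combination q (c 0) (- c 1) (c 2)
    rw [hc, map_zero, eq_comm, Prod.mk_eq_zero, Prod.mk_eq_zero, neg_eq_zero,
      quotient_mk_eq_zero_iff q p hpq] at h1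
    intro i
    fin_cases i
    exacts [h1.1.1, h1.1.2, h1.2]
  have hsp : ⊤ ≤ Submodule.span (ZMod p) (Set.range v) := by
    intro u _
    obtain ⟨r, s, t, hu⟩ := exists_eq_combination q u
    rw [Submodule.mem_span_range_iff_exists_fun]
    refine ⟨![r, -s, t], ?_⟩
    rw [hsum, hu]
    simp
  refine ⟨Module.Basis.mk hli hsp, ?_, ?_, ?_⟩
  · rw [Module.Basis.mk_apply, ← coeffMap_fhClass]
    rfl
  · rw [Module.Basis.mk_apply, ← coeffMap_neg_hgClass q p hpq hp2]
    rfl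
  · rw [Module.Basis.mk_apply, ← coeffMap_fgClass]
    rfl

theorem finrank_HOne_zmod (hpq : (p : ℤ) ∣ q) [Fact p.Prime] :
    Module.finrank (ZMod p) (HOne (ZMod p) (Gamma q)) = 3 := by
  rw [(homEquiv (ZMod p) (Gamma q) ≪≫ₗ
    torsionHomEquiv q (intCast_zmod_eq_zero_of_dvd q p hpq)).finrank_eq, Module.finrank_fin_fun]

/-- Both sides have dimension 3, as `dim H¹ = 3`, and the image contains a basis, so surjectivity
suffices. -/
theorem wedgeCup_zmod_injective (hpq : (p : ℤ) ∣ q) [Fact p.Prime] (hp2 : p ≠ 2) :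
    Function.Injective (wedgeCup (ZMod p) (Gamma q)
      (cup_self_field (Gamma q) (ZMod p) (two_ne_zero_of_odd p hp2))) := by
  obtain ⟨B, h0, h1, h2⟩ := exists_basis_HTwo_zmod q p hpq hp2
  have hfin : Module.Finite (ZMod p) (HOne (ZMod p) (Gamma q)) :=
    Module.finite_of_finrank_pos (by rw [finrank_HOne_zmod q p hpq]; norm_num)
  have hfin2 : Module.Finite (ZMod p) (HTwo (ZMod p) (Gamma q)) := Module.Finite.of_basis B
  have hdim : Module.finrank (ZMod p) (⋀[ZMod p]^2 (HOne (ZMod p) (Gamma q))) =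
      Module.finrank (ZMod p) (HTwo (ZMod p) (Gamma q)) := by
    rw [exteriorPower.finrank_eq, finrank_HOne_zmod q p hpq, Module.finrank_eq_card_basis B]
    rfl
  rw [LinearMap.injective_iff_surjective_of_finrank_eq_finrank hdim, ← LinearMap.range_eq_top,
    ← top_le_iff, ← B.span_eq, Submodule.span_le]
  rintro _ ⟨i, rfl⟩
  fin_cases i
  · exact ⟨_, (wedgeCup_ιMulti _ _ _ _ _).trans h0.symm⟩
  · exact ⟨_, (wedgeCup_ιMulti _ _ _ _ _).trans h1.symm⟩
  · exact ⟨_, (wedgeCup_ιMulti _ _ _ _ _).trans h2.symm⟩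

theorem h_not_lift (hpq : (p : ℤ) ∣ q) [Fact p.Prime] (hq : q ≠ 0) :
    ¬ ∃ φ : Additive (Gamma q) →+ ℤ, modp p φ = h q p hpq := by
  rintro ⟨φ, hφ⟩
  have h1 := h_gen q p hpq 2
  rw [← hφ, modp_apply, gamma_hom_gen_two q hq φ, Int.cast_zero] at h1
  exact zero_ne_one h1

/-- Integral cup products are multiples of `f ∪ g`, whose reduction has first component zero. -/
theorem coeffMap_cup_ne [Fact p.Prime] (hq : q ≠ 0) {w : HTwo (ZMod p) (Gamma q)}
    (hw : (h2Equiv (ZMod p) q w).1 ≠ 0) (a b : HOne ℤ (Gamma q)) :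
    coeffMap (Int.castRingHom (ZMod p)) (Gamma q) (cup ℤ _ a b) ≠ w := by
  rintro rfl
  obtain ⟨n, hn⟩ := AddSubgroup.mem_zmultiples_iff.1 (cup_int_mem_zmultiples q hq a b)
  refine hw ?_
  rw [← hn, map_zsmul, map_zsmul, h2Equiv_fg]
  simp

end GammaCup

end CupNil
end

theorem mainTheorem6 (q : ℤ) (hq : q ≠ 0) :
    -- rational cohomology: `β₁ = 2`, the cup product on `H¹` vanishes, `f ∪ g` maps to `0`
    Module.finrank ℚ (CupNil.HOne ℚ (CupNil.Gamma q)) = 2 ∧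
    CupNil.wedgeCup ℚ (CupNil.Gamma q)
      (CupNil.cup_self_field (CupNil.Gamma q) ℚ two_ne_zero) = 0 ∧
    CupNil.coeffMap (Int.castRingHom ℚ) (CupNil.Gamma q)
      (CupNil.cup ℤ _ (CupNil.homClass (CupNil.f q)) (CupNil.homClass (CupNil.g q))) = 0 ∧
    -- integral cohomology: `H² ≅ ℤ² ⊕ ℤ/q`, with torsion subgroup generated by `f ∪ g`
    Nonempty (CupNil.HTwo ℤ (CupNil.Gamma q) ≃+ (ℤ × ℤ) × ZMod q.natAbs) ∧
    AddCommGroup.torsion (CupNil.HTwo ℤ (CupNil.Gamma q)) =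
      AddSubgroup.zmultiples
        (CupNil.cup ℤ _ (CupNil.homClass (CupNil.f q)) (CupNil.homClass (CupNil.g q))) ∧
    (∀ a b : CupNil.HOne ℤ (CupNil.Gamma q),
      CupNil.cup ℤ _ a b ∈ AddCommGroup.torsion (CupNil.HTwo ℤ (CupNil.Gamma q))) ∧
    -- cohomology modulo a prime divisor of `q`
    ∀ (p : ℕ) [Fact p.Prime] (hpq : (p : ℤ) ∣ q),
      CupNil.cup (ZMod p) _ (CupNil.homClass (CupNil.modp p (CupNil.f q)))
        (CupNil.homClass (CupNil.modp p (CupNil.g q))) ≠ 0 ∧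
      CupNil.wedgeCup ℤ (CupNil.Gamma q) (CupNil.cup_self_int (CupNil.Gamma q)) ≠ 0 ∧
      ∀ hp2 : p ≠ 2,
        Function.Injective (CupNil.wedgeCup (ZMod p) (CupNil.Gamma q)
          (CupNil.cup_self_field (CupNil.Gamma q) (ZMod p) (CupNil.two_ne_zero_of_odd p hp2))) ∧
        Function.Surjective (CupNil.coeffMap (Int.castRingHom (ZMod p)) (CupNil.Gamma q)) ∧
        (∃ B : Module.Basis (Fin 3) (ZMod p) (CupNil.HTwo (ZMod p) (CupNil.Gamma q)),
          B 0 = CupNil.cup (ZMod p) _ (CupNil.homClass (CupNil.modp p (CupNil.f q)))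
            (CupNil.homClass (CupNil.h q p hpq)) ∧
          B 1 = CupNil.cup (ZMod p) _ (CupNil.homClass (CupNil.modp p (CupNil.g q)))
            (CupNil.homClass (CupNil.h q p hpq)) ∧
          B 2 = CupNil.cup (ZMod p) _ (CupNil.homClass (CupNil.modp p (CupNil.f q)))
            (CupNil.homClass (CupNil.modp p (CupNil.g q)))) ∧
        (¬ ∃ φ : Additive (CupNil.Gamma q) →+ ℤ, CupNil.modp p φ = CupNil.h q p hpq) ∧
        ∀ e : Additive (CupNil.Gamma q) →+ ℤ, e = CupNil.f q ∨ e = CupNil.g q →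
          (∃ u : CupNil.HTwo ℤ (CupNil.Gamma q), addOrderOf u = 0 ∧
            CupNil.coeffMap (Int.castRingHom (ZMod p)) (CupNil.Gamma q) u =
              CupNil.cup (ZMod p) _ (CupNil.homClass (CupNil.modp p e))
                (CupNil.homClass (CupNil.h q p hpq))) ∧
          ∀ a b : CupNil.HOne ℤ (CupNil.Gamma q),
            CupNil.coeffMap (Int.castRingHom (ZMod p)) (CupNil.Gamma q) (CupNil.cup ℤ _ a b) ≠
              CupNil.cup (ZMod p) _ (CupNil.homClass (CupNil.modp p e))
                (CupNil.homClass (CupNil.h q p hpq)) := by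
  refine ⟨CupNil.finrank_HOne_charZero q ℚ hq, ?_, CupNil.coeffMap_fgClass_eq_zero q ℚ hq,
    CupNil.nonempty_HTwo_int_equiv q, CupNil.torsion_HTwo_int q hq, fun a b => ?_,
    fun p _ hpq => ⟨?_, fun h0 => ?_, fun hp2 => ⟨CupNil.wedgeCup_zmod_injective q p hpq hp2,
      CupNil.coeffMap_zmod_surjective q p, CupNil.exists_basis_HTwo_zmod q p hpq hp2,
      CupNil.h_not_lift q p hpq hq, ?_⟩⟩⟩
  · refine CupNil.wedgeCup_eq_zero _ fun a b => ?_
    obtain ⟨n, hn⟩ := CupNil.exists_cup_eq_smul q hq (CupNil.cup_self_field _ ℚ two_ne_zero) a b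
    rw [hn, CupNil.coeffMap_fgClass_eq_zero q ℚ hq, smul_zero]
  · rw [CupNil.torsion_HTwo_int q hq]
    exact CupNil.cup_int_mem_zmultiples q hq a b
  · rw [← CupNil.coeffMap_fgClass]
    exact CupNil.coeffMap_fgClass_ne_zero q p hpq
  -- If the integral map were zero, `f ∪ g` and hence its reduction modulo `p` would vanish.
  · refine CupNil.coeffMap_fgClass_ne_zero q p hpq ?_
    rw [CupNil.fgClass, ← CupNil.wedgeCup_ιMulti _ _ (CupNil.cup_self_int _), h0,
      LinearMap.zero_apply, map_zero]
  · rintro e (rfl | rfl)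
    · rw [← CupNil.coeffMap_fhClass]
      refine ⟨⟨_, CupNil.addOrderOf_eq_zero_of_h2Equiv q ?_, rfl⟩,
        CupNil.coeffMap_cup_ne q p hq ?_⟩
      · rw [CupNil.h2Equiv_fhClass]
        simp
      · simp [CupNil.h2Equiv_fh]
    · rw [← CupNil.coeffMap_neg_hgClass q p hpq hp2]
      refine ⟨⟨_, CupNil.addOrderOf_eq_zero_of_h2Equiv q ?_, rfl⟩,
        CupNil.coeffMap_cup_ne q p hq ?_⟩
      · rw [map_neg, CupNil.h2Equiv_hgClass]
        simp
      · simp [CupNil.h2Equiv_hg]
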